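/- Let $k$ be a measurable real positive-definite kernel on $\mathbb{R}^d$, not necessarily bounded (i.e. $k$ is symmetric and all its finite Gram matrices are positive semidefinite), let $\mathcal{H}$ be its reproducing kernel Hilbert space, and for probability measures $\mu_1,\mu_2$ on $\mathbb{R}^d$ let $$\mathcal{D}_{\mathrm{MMD}}(\mu_1,\mu_2)=\sup_{f\in\mathcal{H},\,\|f\|_{\mathcal{H}}\le 1}\Big|\int f\,d\mu_1-\int f\,d\mu_2\Big|\in[0,\infty],$$ with value $\infty$ if some such $f$ is not integrable under $\mu_1$ or $\mu_2$. Let $\{\mu_\theta:\theta\in\Theta\}$, $\Theta\subseteq\mathbb{R}^p$, be a statistical model of probability measures on $\mathbb{R}^d$ depending measurably on $\theta$, $\pi$ a prior probability distribution on $\Theta$, and $\mu^*$ a probability measure on $\mathbb{R}^d$. Put $\varepsilon^*=\inf_{\theta\in\Theta}\mathcal{D}_{\mathrm{MMD}}(\mu_\theta,\mu^*)$. For data $y_{1:n}=(y_1,\dots,y_n)$, i.i.d. from $\mu^*$ with joint law $\mathbb{P}_{y_{1:n}}$, and a threshold $\varepsilon$, the ABC posterior is $$\pi_n^{(\varepsilon)}(d\theta)\propto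 \mu_\theta^{n}\big(\{z_{1:n}:\mathcal{D}_{\mathrm{MMD}}(\hat\mu_{z_{1:n}},\hat\mu_{y_{1:n}})\le\varepsilon\}\big)\,\pi(d\theta),\qquad \hat\mu_{x_{1:n}}=\frac1n\sum_{i=1}^n\delta_{x_i}.$$ Assume: (II) $L>0$ and $c_\pi>0$ are constants such that, for all sufficiently small $\bar\varepsilon>0$, $\pi(\{\theta:\mathcal{D}_{\mathrm{MMD}}(\mu_\theta,\mu^*)\le\varepsilon^*+\bar\varepsilon\})\ge c_\pi\bar\varepsilon^{L}$; (A1) $\mathbb{E}_{y\sim\mu^*}[k(y,y)]<\infty$; (A2) $\int_\Theta\mathbb{E}_{z\sim\mu_\theta}[k(z,z)]\,\pi(d\theta)<\infty$; (A3) there are $\delta_0>0$ and $c_0>0$ such that $\mathbb{E}_{z\sim\mu_\theta}[k(z,z)]<c_0$ for every $\theta\in\Theta$ for which $$\big(\mathbb{E}[k(z,z')]-2\,\mathbb{E}[k(z,y)]+\mathbb{E}[k(y,y')]\big)^{1/2}$$ is well defined and at most $\varepsilon^*+\delta_0$, where $z,z'\sim\mu_\theta$ and $y,y'\sim\mu^*$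 are independent. Then there is a constant $C\in(0,\infty)$ such that, for every sequence $\bar\varepsilon_n>0$ with $\bar\varepsilon_n\to0$ and $n\bar\varepsilon_n^2\to\infty$, and every sequence $M_n\in(0,\infty)$, with $\mathbb{P}_{y_{1:n}}$-probability tending to $1$ as $n\to\infty$ the ABC posterior with threshold $\varepsilon^*+\bar\varepsilon_n$ is well defined (its normalizing constant is positive) and $$\pi_n^{(\varepsilon^*+\bar\varepsilon_n)}\Big(\Big\{\theta:\mathcal{D}_{\mathrm{MMD}}(\mu_\theta,\mu^*)>\varepsilon^*+\frac{4\bar\varepsilon_n}{3}+\Big[\frac{M_n}{n\,\bar\varepsilon_n^{L}}\Big]^{1/2}\Big\}\Big)\le\frac{C}{M_n}.$$ -/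

import Mathlib

open MeasureTheory ProbabilityTheory Filter Topology
open scoped ENNReal

noncomputable section

/-- A real positive-definite kernel on `X`: a symmetric function all of whose finite Gram
matrices are positive semidefinite. No boundedness is required. -/
structure PDKernel (X : Type*) where
  toFun : X → X → ℝ
  symm' : ∀ x y, toFun x y = toFun y x
  nonneg' : ∀ (s : Finset X) (c : X → ℝ), 0 ≤ ∑ x ∈ s, ∑ y ∈ s, c x * c y * toFun x y

namespace PDKernel

variable {X : Type*}

instance : CoeFun (PDKernel X) (fun _ => X → X → ℝ) := ⟨PDKernel.toFun⟩

/-- The kernel as a matrix of operators `ℝ → ℝ`, the form in which Mathlib's construction of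
the reproducing kernel Hilbert space takes a kernel. -/
def matrix (k : PDKernel X) : Matrix X X (ℝ →L[ℝ] ℝ) :=
  Matrix.of fun x y => k x y • ContinuousLinearMap.id ℝ ℝ

theorem posSemidef_matrix (k : PDKernel X) : k.matrix.PosSemidef := by
  have key := (RKHS.posSemidef_tfae (K := k.matrix)).out 0 2
  refine key.mpr ⟨?_, fun v => ?_⟩
  · ext x y
    have h1 : star (ContinuousLinearMap.id ℝ ℝ) = ContinuousLinearMap.id ℝ ℝ :=
      star_one (ℝ →L[ℝ] ℝ)
    simp [matrix, Matrix.conjTranspose_apply, k.symm' x y, h1]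
  · have h := k.nonneg' v.support v
    simp only [Finsupp.sum, matrix, Matrix.of_apply]
    refine h.trans_eq ?_
    simp only [RCLike.re_to_real]
    refine Finset.sum_congr rfl fun x _ => Finset.sum_congr rfl fun y _ => ?_
    simp [k.symm' x y]
    ring

instance (k : PDKernel X) : Fact k.matrix.PosSemidef := ⟨k.posSemidef_matrix⟩

/-- The reproducing kernel Hilbert space of `k`. -/
abbrev Space (k : PDKernel X) : Type _ := RKHS.OfKernel k.matrix

/-- The unit ball of the reproducing kernel Hilbert space of `k`, as a class of functions. -/
def unitBall (k : PDKernel X) : Set (X → ℝ) :=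
  {f | ∃ h : k.Space, ‖h‖ ≤ 1 ∧ f = ⇑h}

end PDKernel

section Discrepancies

variable {Y : Type*} [MeasurableSpace Y]

open Classical in
/-- The integral probability semimetric `sup_{f ∈ F} |∫ f dμ - ∫ f dν|` with values in `[0, ∞]`;
it is `∞` when some `f ∈ F` fails to be integrable for `μ` or `ν`. -/
def ips (F : Set (Y → ℝ)) (μ ν : Measure Y) : ℝ≥0∞ :=
  ⨆ f ∈ F, if Integrable f μ ∧ Integrable f ν
    then ENNReal.ofReal |(∫ y, f y ∂μ) - ∫ y, f y ∂ν| else ∞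

/-- The maximum mean discrepancy of the kernel `k`. -/
def mmd (k : PDKernel Y) (μ ν : Measure Y) : ℝ≥0∞ := ips k.unitBall μ ν

/-- `(E k(z,z') - 2 E k(z,y) + E k(y,y'))^{1/2}` for independent `z, z' ∼ μ` and `y, y' ∼ ν`. -/
def kernelEnergy (k : PDKernel Y) (μ ν : Measure Y) : ℝ :=
  √((∫ q, k q.1 q.2 ∂(μ.prod μ)) - 2 * (∫ q, k q.1 q.2 ∂(μ.prod ν))
    + ∫ q, k q.1 q.2 ∂(ν.prod ν))

/-- `E k(z,z)` for `z ∼ μ`, with values in `[0, ∞]` (the integrand is nonnegative). -/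
def diagMoment (k : PDKernel Y) (μ : Measure Y) : ℝ≥0∞ :=
  ∫⁻ z, ENNReal.ofReal (k z z) ∂μ

/-- The empirical measure `n⁻¹ ∑ δ_{x_i}`. -/
def empirical {n : ℕ} (x : Fin n → Y) : Measure Y :=
  (n : ℝ≥0∞)⁻¹ • ∑ i, Measure.dirac (x i)

/-- The law of an i.i.d. sample of size `n` from `μ`. -/
def iidLaw (n : ℕ) (μ : Measure Y) : Measure (Fin n → Y) := Measure.pi fun _ => μ

variable {T : Type*} [MeasurableSpace T]

/-- The lowest attainable discrepancy `ε* = inf_θ D(μ_θ, μ*)`. -/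
def epsStar (D : Measure Y → Measure Y → ℝ≥0∞) (μ : T → Measure Y) (μs : Measure Y) : ℝ≥0∞ :=
  ⨅ θ, D (μ θ) μs

/-- The probability that a synthetic i.i.d. sample `z` of size `n` from `μ_θ` is accepted, given
the observed sample `y`, the discrepancy `D` and the threshold `ε`. -/
def abcAccept (D : Measure Y → Measure Y → ℝ≥0∞) (μ : T → Measure Y) (ε : ℝ≥0∞) {n : ℕ}
    (y : Fin n → Y) (θ : T) : ℝ≥0∞ :=
  iidLaw n (μ θ) {z | D (empirical z) (empirical y) ≤ ε}

/-- The acceptance probability of rejection ABC, i.e. the normalizing constant of the ABC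
posterior. -/
def abcEvidence (D : Measure Y → Measure Y → ℝ≥0∞) (μ : T → Measure Y) (π : Measure T) (ε : ℝ≥0∞)
    {n : ℕ} (y : Fin n → Y) : ℝ≥0∞ :=
  ∫⁻ θ, abcAccept D μ ε y θ ∂π

/-- The ABC posterior with threshold `ε`; it is a probability measure when `abcEvidence` is not
zero. -/
def abcPosterior (D : Measure Y → Measure Y → ℝ≥0∞) (μ : T → Measure Y) (π : Measure T)
    (ε : ℝ≥0∞) {n : ℕ} (y : Fin n → Y) : Measure T :=
  (abcEvidence D μ π ε y)⁻¹ • π.withDensity (abcAccept D μ ε y)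

end Discrepancies

end

/-! A finite diagonal moment turns integration against `μ` into a bounded functional on the Hilbert
space, so `μ` has a mean embedding and `mmd` is the distance between embeddings
(`mmd_eq_of_isMeanEmbedding`). The embedding of an i.i.d. sample is an average of independent
vectors. Its mean squared error is therefore at most the diagonal moment divided by `n`, and
Chebyshev gives `iidLaw_lt_mmd_empirical_le` without bounding the kernel.

With `e` the excess of the threshold over `E = ε*`, work on the likely event that the data lie
within `e / 3` of `μs`. By the triangle inequality, a parameter beyond `E + 4e/3 + s` is accepted
only if its synthetic sample strays by more than `s` (`abcAccept_mmd_le`); integrating over the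
prior bounds the numerator by a multiple of `1 / (n s²)`. A parameter within `E + e / 3` is accepted
with probability at least one half, so the prior mass condition bounds the evidence below by a
multiple of `e ^ L` (`le_abcEvidence_mmd`). The choice `s² = M / (n e ^ L)` makes the ratio of order
`1 / M`. -/

namespace PDKernel

/-! ### Feature map and reproducing property. -/

section FeatureMap

variable {X : Type*} (k : PDKernel X)

/-- The canonical feature `k(·, x)` as an element of the reproducing kernel Hilbert space. -/
noncomputable def feature (x : X) : k.Space := RKHS.kerFun k.Space x (1 : ℝ)

theorem kerFun_apply_apply (x y : X) (v : ℝ) : RKHS.kerFun k.Space x v y = k y x * v := by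
  rw [RKHS.kerFun_apply, RKHS.OfKernel.kernel_ofKernel]
  simp [matrix]

@[simp]
theorem feature_apply (x y : X) : k.feature x y = k y x := by
  rw [feature, kerFun_apply_apply, mul_one]

theorem inner_feature_left (x : X) (h : k.Space) : inner ℝ (k.feature x) h = h x := by
  simp [feature]

theorem inner_feature_right (x : X) (h : k.Space) : inner ℝ h (k.feature x) = h x := by
  simp [feature]

theorem inner_feature_feature (x y : X) : inner ℝ (k.feature x) (k.feature y) = k x y := by
  rw [inner_feature_left, feature_apply]

theorem norm_feature_sq (x : X) : ‖k.feature x‖ ^ 2 = k x x := by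
  rw [← real_inner_self_eq_norm_sq, inner_feature_feature]

theorem diag_nonneg (x : X) : 0 ≤ k x x := by
  rw [← norm_feature_sq]; positivity

theorem norm_feature (x : X) : ‖k.feature x‖ = √(k x x) := by
  rw [← norm_feature_sq, Real.sqrt_sq (norm_nonneg _)]

theorem abs_le_half_add_diag (x y : X) : |k x y| ≤ (k x x + k y y) / 2 := by
  have h := abs_real_inner_le_norm (k.feature x) (k.feature y)
  rw [inner_feature_feature] at h
  rw [← norm_feature_sq, ← norm_feature_sq]
  nlinarith [sq_nonneg (‖k.feature x‖ - ‖k.feature y‖)]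

theorem abs_apply_le (h : k.Space) (x : X) : |h x| ≤ ‖h‖ * √(k x x) := by
  rw [← inner_feature_right, ← norm_feature]
  exact abs_real_inner_le_norm _ _

/-- This expansion reduces measurability and integrability questions to scalar functions of the
sample, so no Hilbert-space-valued integral is needed. -/
theorem norm_sq_mean_feature_sub {n : ℕ} (m : k.Space) (z : Fin n → X) :
    ‖((n : ℝ)⁻¹ • ∑ i, k.feature (z i)) - m‖ ^ 2 =
      (n : ℝ)⁻¹ ^ 2 * (∑ i, ∑ j, k (z i) (z j)) - 2 * ((n : ℝ)⁻¹ * ∑ i, m (z i)) + ‖m‖ ^ 2 := by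
  rw [norm_sub_sq_real, ← real_inner_self_eq_norm_sq, real_inner_smul_left, real_inner_smul_right,
    real_inner_smul_left, sum_inner, sum_inner]
  simp only [inner_sum, inner_feature_left, feature_apply]
  ring

end FeatureMap

/-! ### Mean embeddings and the closed form of the discrepancy. -/

section MeanEmbedding

variable {X : Type*} [MeasurableSpace X] {k : PDKernel X}

theorem measurable_diag (hk : Measurable fun q : X × X => k q.1 q.2) :
    Measurable fun x => k x x :=
  hk.comp (measurable_id.prodMk measurable_id)

/-- Kernel sections span a dense subspace, and norm convergence implies pointwise convergence
because evaluations are continuous; a pointwise limit of measurable functions is measurable. -/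
theorem measurable_coe (hk : Measurable fun q : X × X => k q.1 q.2) (h : k.Space) :
    Measurable h := by
  have hspan : ∀ g ∈ Submodule.span ℝ {RKHS.kerFun k.Space x v | (x) (v)},
      Measurable (g : X → ℝ) := by
    intro g hg
    induction hg using Submodule.span_induction with
    | mem g hg =>
      obtain ⟨x, v, rfl⟩ := hg
      have : (RKHS.kerFun k.Space x v : X → ℝ) = fun y => k y x * v := by
        funext y
        exact k.kerFun_apply_apply x y v
      rw [this]
      exact (hk.comp (measurable_id.prodMk measurable_const)).mul_const v
    | zero => rw [RKHS.coe_zero]; exact measurable_zero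
    | add f g _ _ hf hg => rw [RKHS.coe_add]; exact hf.add hg
    | smul c f _ hf => rw [RKHS.coe_smul]; exact hf.const_smul c
  have hmem : h ∈ (Submodule.span ℝ {RKHS.kerFun k.Space x v | (x) (v)}).topologicalClosure := by
    rw [RKHS.kerFun_dense]; trivial
  obtain ⟨u, hu, hlim⟩ := mem_closure_iff_seq_limit.mp hmem
  refine measurable_of_tendsto_metrizable (fun n => hspan _ (hu n)) (tendsto_pi_nhds.mpr fun x => ?_)
  exact ((RKHS.continuous_eval x).tendsto h).comp hlim

/-- `m` represents integration against `μ` on the reproducing kernel Hilbert space. -/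
def IsMeanEmbedding (k : PDKernel X) (μ : Measure X) (m : k.Space) : Prop :=
  ∀ h : k.Space, Integrable h μ ∧ ∫ x, h x ∂μ = inner ℝ m h

theorem integrable_diag_iff (hk : Measurable fun q : X × X => k q.1 q.2) {μ : Measure X} :
    Integrable (fun x => k x x) μ ↔ diagMoment k μ < ∞ := by
  rw [diagMoment, lt_top_iff_ne_top, lintegral_ofReal_ne_top_iff_integrable
    (measurable_diag hk).aestronglyMeasurable (ae_of_all _ k.diag_nonneg)]

/-- Riesz representation: `|h x| ≤ ‖h‖ * √(k x x)`, and the square root is integrable, being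
dominated by `1 + k x x`. -/
theorem exists_isMeanEmbedding (hk : Measurable fun q : X × X => k q.1 q.2) (μ : Measure X)
    [IsProbabilityMeasure μ] (hμ : diagMoment k μ < ∞) : ∃ m, IsMeanEmbedding k μ m := by
  have hsqrt : Integrable (fun x => √(k x x)) μ := by
    refine ((integrable_const 1).add ((integrable_diag_iff hk).mpr hμ)).mono'
      (measurable_diag hk).sqrt.aestronglyMeasurable (ae_of_all _ fun x => ?_)
    rw [Real.norm_of_nonneg (Real.sqrt_nonneg _)]
    simp only [Pi.add_apply]
    nlinarith [Real.sq_sqrt (k.diag_nonneg x), sq_nonneg (√(k x x) - 1 / 2)]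
  have hint (h : k.Space) : Integrable h μ :=
    (hsqrt.const_mul ‖h‖).mono' (measurable_coe hk h).aestronglyMeasurable
      (ae_of_all _ (k.abs_apply_le h))
  let ℓ : k.Space →ₗ[ℝ] ℝ :=
    { toFun := fun h => ∫ x, h x ∂μ
      map_add' := fun f g => by
        rw [← integral_add (hint f) (hint g), RKHS.coe_add]; rfl
      map_smul' := fun c f => by
        rw [RKHS.coe_smul]
        exact integral_const_mul c _ }
  let φ : StrongDual ℝ k.Space := ℓ.mkContinuous (∫ x, √(k x x) ∂μ) fun h => by
    rw [mul_comm, ← integral_const_mul]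
    exact norm_integral_le_of_norm_le (hsqrt.const_mul _) (ae_of_all _ (k.abs_apply_le h))
  refine ⟨(InnerProductSpace.toDual ℝ k.Space).symm φ, fun h => ⟨hint h, ?_⟩⟩
  rw [InnerProductSpace.toDual_symm_apply]
  rfl

theorem isMeanEmbedding_empirical (hk : Measurable fun q : X × X => k q.1 q.2) {n : ℕ}
    (hn : n ≠ 0) (x : Fin n → X) :
    IsMeanEmbedding k (empirical x) ((n : ℝ)⁻¹ • ∑ i, k.feature (x i)) := by
  intro h
  have hi (i : Fin n) : Integrable h (Measure.dirac (x i)) :=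
    integrable_dirac' (measurable_coe hk h).stronglyMeasurable enorm_lt_top
  refine ⟨(integrable_finsetSum_measure.mpr fun i _ => hi i).smul_measure (by simp [hn]), ?_⟩
  rw [empirical, integral_smul_measure, integral_finsetSum_measure fun i _ => hi i,
    real_inner_smul_left, sum_inner]
  simp only [integral_dirac' _ _ (measurable_coe hk h).stronglyMeasurable, inner_feature_left]
  simp

theorem mmd_eq_of_isMeanEmbedding {μ ν : Measure X} {m m' : k.Space}
    (hm : IsMeanEmbedding k μ m) (hm' : IsMeanEmbedding k ν m') :
    mmd k μ ν = ENNReal.ofReal ‖m - m'‖ := by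
  have key (h : k.Space) : (∫ x, h x ∂μ) - ∫ x, h x ∂ν = inner ℝ (m - m') h := by
    rw [(hm h).2, (hm' h).2, inner_sub_left]
  apply le_antisymm
  · refine iSup₂_le ?_
    rintro _ ⟨h, hh, rfl⟩
    rw [if_pos ⟨(hm h).1, (hm' h).1⟩, key]
    refine ENNReal.ofReal_le_ofReal ((abs_real_inner_le_norm _ _).trans ?_)
    exact mul_le_of_le_one_right (norm_nonneg _) hh
  -- The supremum is attained at the normalized difference of embeddings; if the difference is zero,
  -- the convention `0⁻¹ = 0` makes the witness the zero function.
  · have hball : ‖(‖m - m'‖⁻¹ • (m - m') : k.Space)‖ ≤ 1 := by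
      rw [norm_smul, norm_inv, norm_norm]
      exact inv_mul_le_one
    refine le_trans ?_ (le_iSup₂_of_le (⇑(‖m - m'‖⁻¹ • (m - m') : k.Space)) ⟨_, hball, rfl⟩ le_rfl)
    rw [if_pos ⟨(hm _).1, (hm' _).1⟩, key, real_inner_smul_right, real_inner_self_eq_norm_sq]
    refine ENNReal.ofReal_le_ofReal (le_trans (le_of_eq ?_) (le_abs_self _))
    rcases eq_or_ne ‖m - m'‖ 0 with h0 | h0
    · simp [h0]
    · field_simp

theorem integrable_prod (hk : Measurable fun q : X × X => k q.1 q.2) {μ ν : Measure X}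
    [IsProbabilityMeasure μ] [IsProbabilityMeasure ν] (hμ : diagMoment k μ < ∞)
    (hν : diagMoment k ν < ∞) : Integrable (fun q : X × X => k q.1 q.2) (μ.prod ν) :=
  (((((integrable_diag_iff hk).mpr hμ).comp_fst ν).add
    (((integrable_diag_iff hk).mpr hν).comp_snd μ)).div_const 2).mono'
    hk.aestronglyMeasurable (ae_of_all _ fun q => k.abs_le_half_add_diag q.1 q.2)

theorem IsMeanEmbedding.apply_eq_integral {μ : Measure X} {m : k.Space}
    (hm : IsMeanEmbedding k μ m) (x : X) : m x = ∫ y, k x y ∂μ := by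
  rw [← inner_feature_right, ← (hm _).2]
  simp only [feature_apply, k.symm']

theorem IsMeanEmbedding.inner_eq_integral (hk : Measurable fun q : X × X => k q.1 q.2)
    {μ ν : Measure X} [IsProbabilityMeasure μ] [IsProbabilityMeasure ν] {m m' : k.Space}
    (hm : IsMeanEmbedding k μ m) (hm' : IsMeanEmbedding k ν m') (hμ : diagMoment k μ < ∞)
    (hν : diagMoment k ν < ∞) : inner ℝ m m' = ∫ q, k q.1 q.2 ∂(μ.prod ν) := by
  rw [← (hm m').2, MeasureTheory.integral_prod _ (integrable_prod hk hμ hν)]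
  exact integral_congr_ae (ae_of_all _ fun x => hm'.apply_eq_integral x)

/-- Bridge between the discrepancy and the energy in which the local moment condition is phrased. -/
theorem mmd_eq_kernelEnergy (hk : Measurable fun q : X × X => k q.1 q.2) {μ ν : Measure X}
    [IsProbabilityMeasure μ] [IsProbabilityMeasure ν] (hμ : diagMoment k μ < ∞)
    (hν : diagMoment k ν < ∞) : mmd k μ ν = ENNReal.ofReal (kernelEnergy k μ ν) := by
  obtain ⟨m, hm⟩ := exists_isMeanEmbedding hk μ hμ
  obtain ⟨m', hm'⟩ := exists_isMeanEmbedding hk ν hν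
  rw [mmd_eq_of_isMeanEmbedding hm hm', kernelEnergy, ← hm.inner_eq_integral hk hm hμ hμ,
    ← hm.inner_eq_integral hk hm' hμ hν, ← hm'.inner_eq_integral hk hm' hν hν,
    real_inner_self_eq_norm_sq, real_inner_self_eq_norm_sq, ← norm_sub_sq_real,
    Real.sqrt_sq (norm_nonneg _)]

end MeanEmbedding

end PDKernel

/-! ### Symmetry and triangle inequality. -/

section Semimetric

variable {Y : Type*} [MeasurableSpace Y]

theorem ips_comm (F : Set (Y → ℝ)) (μ ν : Measure Y) : ips F μ ν = ips F ν μ := by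
  classical
  refine iSup_congr fun f => iSup_congr fun _ => ?_
  rw [abs_sub_comm]
  exact if_congr and_comm rfl rfl

/-- The value `∞` for non-integrable functions makes this unconditional: any failure of
integrability on the left also makes the right side infinite. -/
theorem ips_triangle (F : Set (Y → ℝ)) (μ ν ρ : Measure Y) :
    ips F μ ρ ≤ ips F μ ν + ips F ν ρ := by
  classical
  refine iSup₂_le fun f hf => le_trans ?_ (add_le_add (le_iSup₂ f hf) (le_iSup₂ f hf))
  by_cases h1 : Integrable f μ <;> by_cases h2 : Integrable f ν <;>
    by_cases h3 : Integrable f ρ <;> simp [h1, h2, h3]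
  rw [← ENNReal.ofReal_add (abs_nonneg _) (abs_nonneg _)]
  exact ENNReal.ofReal_le_ofReal (abs_sub_le _ _ _)

theorem mmd_comm (k : PDKernel Y) (μ ν : Measure Y) : mmd k μ ν = mmd k ν μ := ips_comm _ _ _

theorem mmd_triangle (k : PDKernel Y) (μ ν ρ : Measure Y) :
    mmd k μ ρ ≤ mmd k μ ν + mmd k ν ρ := ips_triangle _ _ _ _

end Semimetric

/-! ### I.i.d. samples: second moments, Chebyshev bound, measurability. -/

section Sampling

variable {X : Type*} [MeasurableSpace X]

theorem integral_comp_of_measurePreserving {Y : Type*} [MeasurableSpace Y] {μ : Measure X}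
    {ν : Measure Y} {f : X → Y} (hf : MeasurePreserving f μ ν) {g : Y → ℝ} (hg : Measurable g) :
    ∫ x, g (f x) ∂μ = ∫ y, g y ∂ν := by
  rw [← hf.map_eq, integral_map hf.measurable.aemeasurable hg.aestronglyMeasurable]

instance {n : ℕ} {μ : Measure X} [IsProbabilityMeasure μ] : IsProbabilityMeasure (iidLaw n μ) := by
  unfold iidLaw; infer_instance

theorem measurePreserving_eval_iidLaw {n : ℕ} (μ : Measure X) [IsProbabilityMeasure μ]
    (i : Fin n) : MeasurePreserving (fun z : Fin n → X => z i) (iidLaw n μ) μ :=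
  measurePreserving_eval (fun _ => μ) i

theorem measurePreserving_pair_iidLaw {n : ℕ} (μ : Measure X) [IsProbabilityMeasure μ]
    {i j : Fin n} (hij : i ≠ j) :
    MeasurePreserving (fun z : Fin n → X => (z i, z j)) (iidLaw n μ) (μ.prod μ) := by
  have hi := measurePreserving_eval_iidLaw μ i
  have hj := measurePreserving_eval_iidLaw μ j
  refine ⟨hi.measurable.prodMk hj.measurable, ?_⟩
  have h : IndepFun (fun z : Fin n → X => z i) (fun z => z j) (iidLaw n μ) :=
    (iIndepFun_pi (μ := fun _ : Fin n => μ) (X := fun _ => id) fun _ => aemeasurable_id).indepFun hij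
  rw [(indepFun_iff_map_prod_eq_prod_map_map hi.measurable.aemeasurable
    hj.measurable.aemeasurable).mp h, hi.map_eq, hj.map_eq]

/-- Rectangles form a generating π-system, and on them the law is a finite product of measurable
functions of `θ`. -/
theorem measurable_iidLaw {T : Type*} [MeasurableSpace T] (n : ℕ) (κ : Kernel T X)
    [IsMarkovKernel κ] : Measurable fun θ => iidLaw n (κ θ) := by
  refine Measurable.measure_of_isPiSystem_of_isProbabilityMeasure generateFrom_pi.symm
    isPiSystem_pi ?_
  rintro _ ⟨s, hs, rfl⟩
  simp only [iidLaw, Measure.pi_pi]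
  exact Finset.measurable_fun_prod _ fun i _ => κ.measurable_coe (hs i (Set.mem_univ i))

namespace PDKernel

variable {k : PDKernel X}

theorem integrable_kernel_iidLaw (hk : Measurable fun q : X × X => k q.1 q.2) {n : ℕ}
    {μ : Measure X} [IsProbabilityMeasure μ] (hμ : diagMoment k μ < ∞) (i j : Fin n) :
    Integrable (fun z => k (z i) (z j)) (iidLaw n μ) := by
  have hd (i : Fin n) := (measurePreserving_eval_iidLaw μ i).integrable_comp_of_integrable
    ((integrable_diag_iff hk).mpr hμ)
  have hmeas : Measurable fun z : Fin n → X => k (z i) (z j) :=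
    hk.comp (f := fun z : Fin n → X => (z i, z j))
      ((measurable_pi_apply i).prodMk (measurable_pi_apply j))
  exact (((hd i).add (hd j)).div_const 2).mono' hmeas.aestronglyMeasurable
    (ae_of_all _ fun z => k.abs_le_half_add_diag _ _)

theorem integrable_norm_sq_mean_feature_sub (hk : Measurable fun q : X × X => k q.1 q.2) {n : ℕ}
    {μ : Measure X} [IsProbabilityMeasure μ] (hμ : diagMoment k μ < ∞) {m : k.Space}
    (hm : IsMeanEmbedding k μ m) :
    Integrable (fun z => ‖((n : ℝ)⁻¹ • ∑ i, k.feature (z i)) - m‖ ^ 2) (iidLaw n μ) := by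
  simp only [norm_sq_mean_feature_sub]
  refine Integrable.add (Integrable.sub (Integrable.const_mul (integrable_finsetSum _ fun i _ =>
    integrable_finsetSum _ fun j _ => integrable_kernel_iidLaw hk hμ i j) _)
    (Integrable.const_mul (Integrable.const_mul (integrable_finsetSum _ fun i _ => ?_) _) _))
    (integrable_const _)
  exact (measurePreserving_eval_iidLaw μ i).integrable_comp_of_integrable (hm m).1

/-- Off-diagonal pairs are independent and contribute `‖m‖ ^ 2` each, so the exact value is `((∫ x,
k x x ∂μ) - ‖m‖ ^ 2) / n`; the negative term is dropped. -/
theorem integral_norm_sq_mean_feature_sub_le (hk : Measurable fun q : X × X => k q.1 q.2) {n : ℕ}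
    (hn : n ≠ 0) {μ : Measure X} [IsProbabilityMeasure μ] (hμ : diagMoment k μ < ∞) {m : k.Space}
    (hm : IsMeanEmbedding k μ m) :
    ∫ z, ‖((n : ℝ)⁻¹ • ∑ i, k.feature (z i)) - m‖ ^ 2 ∂(iidLaw n μ) ≤ (∫ x, k x x ∂μ) / n := by
  have hn' : (n : ℝ) ≠ 0 := Nat.cast_ne_zero.mpr hn
  have hkk (i j : Fin n) := integrable_kernel_iidLaw hk hμ i j
  have hmi (i : Fin n) : Integrable (fun z => m (z i)) (iidLaw n μ) :=
    (measurePreserving_eval_iidLaw μ i).integrable_comp_of_integrable (hm m).1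
  have hint_m (i : Fin n) : ∫ z, m (z i) ∂(iidLaw n μ) = ‖m‖ ^ 2 := by
    rw [← real_inner_self_eq_norm_sq, ← (hm m).2]
    exact integral_comp_of_measurePreserving (measurePreserving_eval_iidLaw μ i)
      (measurable_coe hk m)
  have hint_k (i j : Fin n) : ∫ z, k (z i) (z j) ∂(iidLaw n μ) =
      ‖m‖ ^ 2 + if i = j then (∫ x, k x x ∂μ) - ‖m‖ ^ 2 else 0 := by
    split_ifs with hij
    · subst hij
      rw [add_sub_cancel]
      exact integral_comp_of_measurePreserving (measurePreserving_eval_iidLaw μ i)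
        (measurable_diag hk)
    · rw [add_zero, ← real_inner_self_eq_norm_sq, hm.inner_eq_integral hk hm hμ hμ]
      exact integral_comp_of_measurePreserving (measurePreserving_pair_iidLaw μ hij) hk
  have hsum_k : ∫ z, ∑ i, ∑ j, k (z i) (z j) ∂(iidLaw n μ) =
      n * (n * ‖m‖ ^ 2) + n * ((∫ x, k x x ∂μ) - ‖m‖ ^ 2) := by
    rw [integral_finsetSum _ fun i _ => integrable_finsetSum _ fun j _ => hkk i j]
    simp only [integral_finsetSum _ fun j _ => hkk _ j, hint_k, Finset.sum_add_distrib,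
      Finset.sum_ite_eq, Finset.mem_univ, if_true, Finset.sum_const, Finset.card_univ,
      Fintype.card_fin, nsmul_eq_mul]
  have hsum_m : ∫ z, ∑ i, m (z i) ∂(iidLaw n μ) = n * ‖m‖ ^ 2 := by
    rw [integral_finsetSum _ fun i _ => hmi i]
    simp [hint_m]
  have hK := integrable_finsetSum Finset.univ fun i _ =>
    integrable_finsetSum Finset.univ fun j _ => hkk i j
  have hM := integrable_finsetSum Finset.univ fun i _ => hmi i
  simp only [norm_sq_mean_feature_sub]
  have hKM : Integrable (fun z => (n : ℝ)⁻¹ ^ 2 * (∑ i, ∑ j, k (z i) (z j))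
      - 2 * ((n : ℝ)⁻¹ * ∑ i, m (z i))) (iidLaw n μ) :=
    (hK.const_mul _).sub ((hM.const_mul _).const_mul _)
  rw [integral_add hKM (integrable_const _),
    integral_sub (hK.const_mul _) ((hM.const_mul _).const_mul _), integral_const_mul,
    integral_const_mul, integral_const_mul, hsum_k, hsum_m, integral_const, probReal_univ,
    smul_eq_mul, one_mul]
  have : (n : ℝ)⁻¹ ^ 2 * (n * (n * ‖m‖ ^ 2) + n * ((∫ x, k x x ∂μ) - ‖m‖ ^ 2))
      - 2 * ((n : ℝ)⁻¹ * (n * ‖m‖ ^ 2)) + ‖m‖ ^ 2 = ((∫ x, k x x ∂μ) - ‖m‖ ^ 2) / n := by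
    field_simp
    ring
  rw [this]
  gcongr
  nlinarith [sq_nonneg ‖m‖]

/-- A Chebyshev bound for the discrepancy between an i.i.d. sample and its law. -/
theorem iidLaw_lt_mmd_empirical_le (hk : Measurable fun q : X × X => k q.1 q.2) {n : ℕ}
    (hn : n ≠ 0) (μ : Measure X) [IsProbabilityMeasure μ] {t : ℝ} (ht : 0 < t) :
    iidLaw n μ {z | ENNReal.ofReal t < mmd k (empirical z) μ} ≤
      diagMoment k μ / ENNReal.ofReal (n * t ^ 2) := by
  have hn' : (0 : ℝ) < n := by positivity
  -- For an infinite moment the bound is `∞`. Covering this case allows the estimate at every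
  -- parameter, although moments are finite only almost everywhere under the prior.
  rcases eq_or_ne (diagMoment k μ) ∞ with hμ | hμ
  · rw [hμ, ENNReal.top_div_of_ne_top ENNReal.ofReal_ne_top]
    exact le_top
  replace hμ := lt_top_iff_ne_top.mpr hμ
  obtain ⟨m, hm⟩ := exists_isMeanEmbedding hk μ hμ
  have hF := integrable_norm_sq_mean_feature_sub (n := n) hk hμ hm
  have hsub : {z : Fin n → X | ENNReal.ofReal t < mmd k (empirical z) μ} ⊆
      {z | ENNReal.ofReal (t ^ 2) ≤
        ENNReal.ofReal (‖((n : ℝ)⁻¹ • ∑ i, k.feature (z i)) - m‖ ^ 2)} := by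
    intro z hz
    rw [Set.mem_ofPred_eq, mmd_eq_of_isMeanEmbedding (isMeanEmbedding_empirical hk hn z) hm,
      ENNReal.ofReal_lt_ofReal_iff_of_nonneg ht.le] at hz
    exact ENNReal.ofReal_le_ofReal (by gcongr)
  refine (measure_mono hsub).trans ((meas_ge_le_lintegral_div hF.aemeasurable.ennreal_ofReal
    (by simpa using by positivity) ENNReal.ofReal_ne_top).trans ?_)
  rw [← ofReal_integral_eq_lintegral_ofReal hF (ae_of_all _ fun _ => by positivity), diagMoment,
    ← ofReal_integral_eq_lintegral_ofReal ((integrable_diag_iff hk).mpr hμ)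
      (ae_of_all _ k.diag_nonneg), ← ENNReal.ofReal_div_of_pos (by positivity),
    ← ENNReal.ofReal_div_of_pos (by positivity), ← div_div]
  gcongr
  exact integral_norm_sq_mean_feature_sub_le hk hn hμ hm

theorem measurable_mmd_empirical_empirical (hk : Measurable fun q : X × X => k q.1 q.2) {n : ℕ}
    (hn : n ≠ 0) (y : Fin n → X) : Measurable fun z : Fin n → X =>
      mmd k (empirical z) (empirical y) := by
  have hy := isMeanEmbedding_empirical hk hn y
  have (z : Fin n → X) := mmd_eq_of_isMeanEmbedding (isMeanEmbedding_empirical hk hn z) hy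
  simp only [this]
  refine ENNReal.measurable_ofReal.comp ?_
  rw [show (fun z : Fin n → X => ‖((n : ℝ)⁻¹ • ∑ i, k.feature (z i)) -
      (n : ℝ)⁻¹ • ∑ i, k.feature (y i)‖) = fun z => √((n : ℝ)⁻¹ ^ 2 * (∑ i, ∑ j, k (z i) (z j))
        - 2 * ((n : ℝ)⁻¹ * ∑ i, ((n : ℝ)⁻¹ • ∑ i, k.feature (y i) : k.Space) (z i))
        + ‖(n : ℝ)⁻¹ • ∑ i, k.feature (y i)‖ ^ 2) from funext fun z => by
    rw [← norm_sq_mean_feature_sub, Real.sqrt_sq (norm_nonneg _)]]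
  refine Measurable.sqrt (Measurable.add_const (Measurable.sub (Measurable.const_mul
    (Finset.measurable_fun_sum _ fun i _ => Finset.measurable_fun_sum _ fun j _ =>
      hk.comp ((measurable_pi_apply i).prodMk (measurable_pi_apply j))) _)
    (Measurable.const_mul (Measurable.const_mul (Finset.measurable_fun_sum _ fun i _ =>
      (measurable_coe hk _).comp (measurable_pi_apply i)) _) _)) _)

theorem measurable_abcAccept_mmd (hk : Measurable fun q : X × X => k q.1 q.2) {n : ℕ}
    (hn : n ≠ 0) {T : Type*} [MeasurableSpace T] (κ : Kernel T X) [IsMarkovKernel κ] (ε : ℝ≥0∞)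
    (y : Fin n → X) : Measurable (abcAccept (mmd k) κ ε y) :=
  (Measure.measurable_coe (measurableSet_le (measurable_mmd_empirical_empirical hk hn y)
    measurable_const)).comp (measurable_iidLaw n κ)

theorem measurable_diagMoment (hk : Measurable fun q : X × X => k q.1 q.2) {T : Type*}
    [MeasurableSpace T] (κ : Kernel T X) : Measurable fun θ => diagMoment k (κ θ) :=
  (measurable_diag hk).ennreal_ofReal.lintegral_kernel

end PDKernel

end Sampling

/-! ### Acceptance probabilities, evidence and posterior mass. -/

section Concentration

variable {X T : Type*} [MeasurableSpace X] {k : PDKernel X}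

/-- If the observed sample is close to its law, then a parameter whose discrepancy exceeds the
threshold by more than the margin `s` is accepted only if the synthetic sample is atypical. -/
theorem abcAccept_mmd_le (hk : Measurable fun q : X × X => k q.1 q.2) {n : ℕ} (hn : n ≠ 0)
    {μ : T → Measure X} {μs : Measure X} {E : ℝ≥0∞} {e s : ℝ} (he : 0 < e) (hs : 0 < s)
    {y : Fin n → X} (hy : mmd k (empirical y) μs ≤ ENNReal.ofReal (e / 3)) {θ : T}
    [IsProbabilityMeasure (μ θ)] (hθ : E + ENNReal.ofReal (4 * e / 3 + s) < mmd k (μ θ) μs) :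
    abcAccept (mmd k) μ (E + ENNReal.ofReal e) y θ ≤
      diagMoment k (μ θ) / ENNReal.ofReal (n * s ^ 2) := by
  refine (measure_mono fun z hz => ?_).trans (PDKernel.iidLaw_lt_mmd_empirical_le hk hn (μ θ) hs)
  rw [Set.mem_ofPred_eq] at hz ⊢
  by_contra! hlt
  refine hθ.not_ge ?_
  calc mmd k (μ θ) μs
      ≤ mmd k (μ θ) (empirical z) + (mmd k (empirical z) (empirical y)
          + mmd k (empirical y) μs) :=
        (mmd_triangle _ _ _ _).trans (add_le_add le_rfl (mmd_triangle _ _ _ _))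
    _ ≤ ENNReal.ofReal s + (E + ENNReal.ofReal e + ENNReal.ofReal (e / 3)) := by
        rw [mmd_comm]; gcongr
    _ = E + ENNReal.ofReal (4 * e / 3 + s) := by
        rw [add_assoc, add_left_comm, ← ENNReal.ofReal_add he.le (by positivity),
          ← ENNReal.ofReal_add hs.le (by positivity)]
        ring_nf

/-- The slack `e` is split into thirds: synthetic sample to `μ θ`, excess of `μ θ` over `E`, and
`μs` to data. Chebyshev at `e / 3` gives `9 * c / (n * e ^ 2)`, which is at most one half by the
factor 18. -/
theorem half_le_abcAccept_mmd (hk : Measurable fun q : X × X => k q.1 q.2) {n : ℕ} (hn : n ≠ 0)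
    {μ : T → Measure X} {μs : Measure X} {E : ℝ≥0∞} {e c : ℝ} (he : 0 < e)
    (hc : 18 * c ≤ n * e ^ 2) {y : Fin n → X}
    (hy : mmd k (empirical y) μs ≤ ENNReal.ofReal (e / 3)) {θ : T}
    [IsProbabilityMeasure (μ θ)] (hθ : mmd k (μ θ) μs ≤ E + ENNReal.ofReal (e / 3))
    (hd : diagMoment k (μ θ) ≤ ENNReal.ofReal c) :
    2⁻¹ ≤ abcAccept (mmd k) μ (E + ENNReal.ofReal e) y θ := by
  have hn' : (0 : ℝ) < n := by positivity
  set A := {z : Fin n → X | mmd k (empirical z) (empirical y) ≤ E + ENNReal.ofReal e}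
  have hcompl : iidLaw n (μ θ) Aᶜ ≤ 2⁻¹ := by
    calc iidLaw n (μ θ) Aᶜ
        ≤ iidLaw n (μ θ) {z | ENNReal.ofReal (e / 3) < mmd k (empirical z) (μ θ)} := by
          refine measure_mono fun z hz => ?_
          rw [Set.mem_ofPred_eq]
          by_contra! hlt
          refine hz ?_
          calc mmd k (empirical z) (empirical y)
              ≤ mmd k (empirical z) (μ θ) + (mmd k (μ θ) μs + mmd k μs (empirical y)) :=
                (mmd_triangle _ _ _ _).trans (add_le_add le_rfl (mmd_triangle _ _ _ _))
            _ ≤ ENNReal.ofReal (e / 3) + (E + ENNReal.ofReal (e / 3)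
                  + ENNReal.ofReal (e / 3)) := by
                rw [mmd_comm k μs]; gcongr
            _ = E + ENNReal.ofReal e := by
                rw [add_assoc, add_left_comm, ← ENNReal.ofReal_add (by positivity) (by positivity),
                  ← ENNReal.ofReal_add (by positivity) (by positivity)]
                ring_nf
      _ ≤ diagMoment k (μ θ) / ENNReal.ofReal (n * (e / 3) ^ 2) :=
          PDKernel.iidLaw_lt_mmd_empirical_le hk hn (μ θ) (by positivity)
      _ ≤ ENNReal.ofReal c / ENNReal.ofReal (n * (e / 3) ^ 2) := by gcongr
      _ = ENNReal.ofReal (c / (n * (e / 3) ^ 2)) :=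
          (ENNReal.ofReal_div_of_pos (by positivity)).symm
      _ ≤ ENNReal.ofReal 2⁻¹ := by
          refine ENNReal.ofReal_le_ofReal ?_
          rw [div_le_iff₀ (by positivity)]
          linarith
      _ = 2⁻¹ := by rw [ENNReal.ofReal_inv_of_pos two_pos, ENNReal.ofReal_ofNat]
  -- Subadditivity suffices here, so measurability of `A` is not needed.
  have hone : (1 : ℝ≥0∞) ≤ iidLaw n (μ θ) A + iidLaw n (μ θ) Aᶜ := by
    rw [← measure_univ (μ := iidLaw n (μ θ)), ← Set.union_compl_self A]
    exact measure_union_le _ _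
  rw [← ENNReal.inv_two_add_inv_two] at hone
  exact (ENNReal.add_le_add_iff_right (by simp)).mp (hone.trans (add_le_add le_rfl hcompl))

variable [MeasurableSpace T]

/-- Markov's inequality for the acceptance probability at level one half. -/
theorem le_abcEvidence_mmd (hk : Measurable fun q : X × X => k q.1 q.2) {n : ℕ} (hn : n ≠ 0)
    (μ : Kernel T X) [IsMarkovKernel μ] (π : Measure T) {μs : Measure X} {E : ℝ≥0∞} {e c : ℝ}
    (he : 0 < e) (hc : 18 * c ≤ n * e ^ 2) {y : Fin n → X}
    (hy : mmd k (empirical y) μs ≤ ENNReal.ofReal (e / 3))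
    (hd : ∀ᵐ θ ∂π, mmd k (μ θ) μs ≤ E + ENNReal.ofReal (e / 3) →
      diagMoment k (μ θ) ≤ ENNReal.ofReal c) :
    2⁻¹ * π {θ | mmd k (μ θ) μs ≤ E + ENNReal.ofReal (e / 3)} ≤
      abcEvidence (mmd k) μ π (E + ENNReal.ofReal e) y := by
  refine le_trans ?_ (mul_meas_ge_le_lintegral (PDKernel.measurable_abcAccept_mmd hk hn μ _ y) 2⁻¹)
  refine mul_le_mul_right (measure_mono_ae ?_) _
  filter_upwards [hd] with θ hθ hmem
  exact half_le_abcAccept_mmd hk hn he hc hy hmem (hθ hmem)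

/-- The Chebyshev bound is integrated over the far parameters and the domain is then enlarged to all
of `T`. An s-finite prior lets the density be evaluated on the far set without proving that set
measurable. -/
theorem abcPosterior_mmd_le (hk : Measurable fun q : X × X => k q.1 q.2) {n : ℕ} (hn : n ≠ 0)
    (μ : Kernel T X) [IsMarkovKernel μ] (π : Measure T) [SFinite π] {μs : Measure X} {E : ℝ≥0∞}
    {e s : ℝ} (he : 0 < e) (hs : 0 < s) {y : Fin n → X}
    (hy : mmd k (empirical y) μs ≤ ENNReal.ofReal (e / 3)) :
    abcPosterior (mmd k) μ π (E + ENNReal.ofReal e) y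
        {θ | E + ENNReal.ofReal (4 * e / 3 + s) < mmd k (μ θ) μs} ≤
      (abcEvidence (mmd k) μ π (E + ENNReal.ofReal e) y)⁻¹ *
        ((∫⁻ θ, diagMoment k (μ θ) ∂π) / ENNReal.ofReal (n * s ^ 2)) := by
  have hmeas := PDKernel.measurable_diagMoment hk μ
  rw [abcPosterior, Measure.smul_apply, smul_eq_mul, withDensity_apply']
  gcongr
  rw [div_eq_mul_inv (∫⁻ θ, diagMoment k (μ θ) ∂π), ← lintegral_mul_const _ hmeas]
  exact (setLIntegral_mono (hmeas.mul_const _) fun θ hθ =>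
    abcAccept_mmd_le hk hn he hs hy hθ).trans (setLIntegral_le_lintegral _ _)

/-- An i.i.d. sample is eventually within any threshold of order larger than `n^{-1/2}` of its
law. -/
theorem tendsto_iidLaw_mmd_empirical_le (hk : Measurable fun q : X × X => k q.1 q.2)
    (μ : Measure X) [IsProbabilityMeasure μ] (hμ : diagMoment k μ < ∞) {t : ℕ → ℝ}
    (ht : ∀ᶠ n in atTop, 0 < t n) (hlim : Tendsto (fun n : ℕ => (n : ℝ) * t n ^ 2) atTop atTop) :
    Tendsto (fun n : ℕ => iidLaw n μ {z | mmd k (empirical z) μ ≤ ENNReal.ofReal (t n)})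
      atTop (𝓝 1) := by
  have hbound : Tendsto (fun n : ℕ => 1 - diagMoment k μ / ENNReal.ofReal (n * t n ^ 2))
      atTop (𝓝 1) := by
    have h := ENNReal.Tendsto.const_div (ENNReal.tendsto_ofReal_nhds_top.mpr hlim)
      (a := diagMoment k μ) (Or.inr hμ.ne)
    rw [ENNReal.div_top] at h
    simpa using ENNReal.Tendsto.sub tendsto_const_nhds h (Or.inl ENNReal.one_ne_top)
  refine tendsto_of_tendsto_of_tendsto_of_le_of_le' hbound tendsto_const_nhds ?_
    (Eventually.of_forall fun n => prob_le_one)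
  filter_upwards [ht, eventually_ne_atTop 0] with n htn hn
  refine tsub_le_iff_right.mpr ?_
  have hone : (1 : ℝ≥0∞) ≤ iidLaw n μ {z | mmd k (empirical z) μ ≤ ENNReal.ofReal (t n)}
      + iidLaw n μ {z | mmd k (empirical z) μ ≤ ENNReal.ofReal (t n)}ᶜ := by
    rw [← measure_univ (μ := iidLaw n μ), ← Set.union_compl_self]
    exact measure_union_le _ _
  refine hone.trans (add_le_add le_rfl (le_trans (measure_mono fun z hz => ?_)
    (PDKernel.iidLaw_lt_mmd_empirical_le hk hn μ htn)))
  simpa using hz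

end Concentration

/-! ### The concentration theorem. -/

theorem mainTheorem9 {d p : ℕ}
    -- the kernel on `ℝ^d`
    (k : PDKernel (EuclideanSpace ℝ (Fin d)))
    (hk : Measurable fun q : EuclideanSpace ℝ (Fin d) × EuclideanSpace ℝ (Fin d) => k q.1 q.2)
    -- the model, the prior and the data generating process
    (Θ : Set (EuclideanSpace ℝ (Fin p)))
    (μ : Kernel Θ (EuclideanSpace ℝ (Fin d))) [IsMarkovKernel μ]
    (π : Measure Θ) [IsProbabilityMeasure π]
    (μs : Measure (EuclideanSpace ℝ (Fin d))) [IsProbabilityMeasure μs]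
    -- (II)
    (L cπ : ℝ) (hL : 0 < L) (hcπ : 0 < cπ)
    (hII : ∀ᶠ e : ℝ in 𝓝[>] 0, ENNReal.ofReal (cπ * e ^ L) ≤
      π {θ | mmd k (μ θ) μs ≤ epsStar (mmd k) μ μs + ENNReal.ofReal e})
    -- (A1)
    (hA1 : diagMoment k μs < ∞)
    -- (A2)
    (hA2 : ∫⁻ θ, diagMoment k (μ θ) ∂π < ∞)
    -- (A3); the two integrability conditions say that `kernelEnergy` is well defined
    (hA3 : ∃ δ₀ > (0 : ℝ), ∃ c₀ > (0 : ℝ), ∀ θ,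
      Integrable (fun q => k q.1 q.2) ((μ θ).prod (μ θ)) →
      Integrable (fun q => k q.1 q.2) ((μ θ).prod μs) →
      ENNReal.ofReal (kernelEnergy k (μ θ) μs) ≤
        epsStar (mmd k) μ μs + ENNReal.ofReal δ₀ →
      diagMoment k (μ θ) < ENNReal.ofReal c₀) :
    ∃ C : ℝ, 0 < C ∧
      ∀ ε : ℕ → ℝ, (∀ᶠ n in atTop, 0 < ε n) → Tendsto ε atTop (𝓝 0) →
        Tendsto (fun n : ℕ => (n : ℝ) * ε n ^ 2) atTop atTop →
      ∀ M : ℕ → ℝ, (∀ᶠ n in atTop, 0 < M n) →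
        Tendsto (fun n : ℕ => iidLaw n μs
          {y | abcEvidence (mmd k) μ π (epsStar (mmd k) μ μs + ENNReal.ofReal (ε n)) y ≠ 0 ∧
            abcPosterior (mmd k) μ π (epsStar (mmd k) μ μs + ENNReal.ofReal (ε n)) y
              {θ | epsStar (mmd k) μ μs
                  + ENNReal.ofReal (4 * ε n / 3 + √(M n / (n * ε n ^ L)))
                < mmd k (μ θ) μs}
              ≤ ENNReal.ofReal (C / M n)})
          atTop (𝓝 1) := by
  obtain ⟨δ₀, hδ₀, c₀, hc₀, hA3⟩ := hA3
  set E := epsStar (mmd k) μ μs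
  set A := (∫⁻ θ, diagMoment k (μ θ) ∂π).toReal with hA_def
  have hA : ENNReal.ofReal A = ∫⁻ θ, diagMoment k (μ θ) ∂π := ENNReal.ofReal_toReal hA2.ne
  have hA0 : 0 ≤ A := ENNReal.toReal_nonneg
  have hdiag : ∀ᵐ θ ∂π, diagMoment k (μ θ) < ∞ :=
    ae_lt_top (PDKernel.measurable_diagMoment hk μ) hA2.ne
  -- The ratio of `A * ε n ^ L / M n` to the evidence bound `cπ * (ε n / 3) ^ L / 2` is `2 * 3 ^ L *
  -- A / cπ / M n`; the `+ 1` keeps the constant positive when `A = 0`.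
  refine ⟨2 * 3 ^ L * A / cπ + 1, by positivity, fun ε hε hε0 hnε M hM => ?_⟩
  have hε3 : Tendsto (fun n => ε n / 3) atTop (𝓝 0) := by simpa using hε0.div_const 3
  have hε3pos : ∀ᶠ n in atTop, 0 < ε n / 3 := hε.mono fun n hn => by positivity
  have hnε3 : Tendsto (fun n : ℕ => (n : ℝ) * (ε n / 3) ^ 2) atTop atTop := by
    refine (hnε.atTop_div_const (show (0 : ℝ) < 9 by norm_num)).congr fun n => ?_
    ring
  refine tendsto_of_tendsto_of_tendsto_of_le_of_le'
    (tendsto_iidLaw_mmd_empirical_le hk μs hA1 hε3pos hnε3) tendsto_const_nhds ?_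
    (Eventually.of_forall fun n => prob_le_one)
  have hprior := (tendsto_nhdsWithin_iff.mpr ⟨hε3, hε3pos⟩).eventually hII
  filter_upwards [hε, hM, hprior, hε3.eventually_lt_const hδ₀, eventually_ne_atTop 0,
    hnε.eventually_ge_atTop (18 * c₀)] with n he hMn hpr hδ hn hlarge
  have hn' : (0 : ℝ) < n := by positivity
  have heL : 0 < ε n ^ L := Real.rpow_pos_of_pos he L
  have h3L : (0 : ℝ) < 3 ^ L := Real.rpow_pos_of_pos three_pos L
  refine measure_mono fun y hy => ?_
  rw [Set.mem_ofPred_eq] at hy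
  have hclose : ∀ᵐ θ ∂π, mmd k (μ θ) μs ≤ E + ENNReal.ofReal (ε n / 3) →
      diagMoment k (μ θ) ≤ ENNReal.ofReal c₀ := by
    -- Finite moments, available for almost every `θ`, make the energy well defined and equal to
    -- `mmd`; then `ε n / 3 < δ₀` brings the local moment bound into play.
    filter_upwards [hdiag] with θ hθ hmem
    refine (hA3 θ (PDKernel.integrable_prod hk hθ hθ) (PDKernel.integrable_prod hk hθ hA1) ?_).le
    rw [← PDKernel.mmd_eq_kernelEnergy hk hθ hA1]
    exact hmem.trans (by gcongr)
  have hevid : ENNReal.ofReal (cπ * ε n ^ L / (2 * 3 ^ L)) ≤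
      abcEvidence (mmd k) μ π (E + ENNReal.ofReal (ε n)) y := by
    refine le_trans (le_trans (le_of_eq ?_) (mul_le_mul_right hpr 2⁻¹))
      (le_abcEvidence_mmd hk hn μ π he hlarge hy hclose)
    rw [← ENNReal.ofReal_ofNat 2, ← ENNReal.ofReal_inv_of_pos two_pos,
      ← ENNReal.ofReal_mul (by norm_num), Real.div_rpow he.le three_pos.le]
    congr 1
    field_simp
  have hs : 0 < √(M n / (n * ε n ^ L)) := by positivity
  refine ⟨((ENNReal.ofReal_pos.mpr (by positivity)).trans_le hevid).ne',
    (abcPosterior_mmd_le hk hn μ π he hs hy).trans ?_⟩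
  rw [← hA, Real.sq_sqrt (by positivity)]
  calc _ ≤ (ENNReal.ofReal (cπ * ε n ^ L / (2 * 3 ^ L)))⁻¹ *
        (ENNReal.ofReal A / ENNReal.ofReal (n * (M n / (n * ε n ^ L)))) := by gcongr
    _ = ENNReal.ofReal ((2 * 3 ^ L * A / cπ) / M n) := by
        rw [← ENNReal.ofReal_inv_of_pos (by positivity), ← ENNReal.ofReal_div_of_pos (by positivity),
          ← ENNReal.ofReal_mul (by positivity)]
        congr 1
        field_simp
    _ ≤ _ := by
        gcongr
        linarith
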